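/- **Matrix tree theorem for skew gain graphs.** Let $F$ be a field of characteristic zero, with algebraic closure $\overline F$, and let $f:F^\times\to F^\times$ be an involutive homomorphism ($f(xy)=f(y)f(x)$, $f(f(x))=x$); put $g(x)=x\,f(x)$. Let $G$ be a finite simple graph with $n$ vertices (not necessarily connected), and let $\varphi$ assign to every oriented edge $uv$ of $G$ an element $\varphi(uv)\in F^\times$ with $\varphi(vu)=f(\varphi(uv))$. Write $\Phi_f=(G,F^\times,\varphi,f)$ for this skew gain graph. Since $g(f(x))=g(x)$, the value $g(\varphi(e))$ does not depend on the orientation of the edge $e$. For every edge $e$ choose a square root $\sqrt{g(\varphi(e))}\in\overline F$, and for a set $S$ of edges let $\sqrt{\prod_{e\in S}g(\varphi(e))}$ denote the square root $\prod_{e\in S}\sqrt{g(\varphi(e))}$ of the product. The $g$-Laplacian is the $n\times n$ matrix $L_g(\Phi_f)=D_g-A$ over $\overline F$, where $A$ has $(u,v)$ entry $\varphi(uv)$ if $u$ and $v$ are adjacent and $0$ otherwise, and $D_g$ is diagonal with entry $\sum_{e\ni v}\sqrt{g(\varphi(e))}$ at $v$, the sum being over the edges incident with $v$. A $1$-tree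 is a connected graph with exactly one cycle, and a $1$-forest is a graph all of whose components are $1$-trees. Let $\mathfrak E(G)$ be the set of spanning subgraphs of $G$ that are $1$-forests (the essential spanning subgraphs). For a $1$-tree component $\psi$ of $\Psi\in\mathfrak E(G)$ let $C_\psi$ be its unique cycle, and let $\varphi(C_\psi)$ be the product of the gains of the oriented edges met when $C_\psi$ is traversed once, from any starting vertex and in either direction. Then, for every choice of the square roots and of the traversals, $$\det L_g(\Phi_f)=\sum_{\Psi\in\mathfrak E(G)}\ \prod_{\psi}\ \sqrt{\prod_{e\in E(\psi)\setminus E(C_\psi)}g(\varphi(e))}\,\Bigl(2\sqrt{\prod_{e\in E(C_\psi)}g(\varphi(e))}-\bigl[\varphi(C_\psi)+f(\varphi(C_\psi))\bigr]\Bigr),$$ where the inner product runs over all components $\psi$ of $\Psi$. -/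

import Mathlib

/-- An anti-involution of a group: an anti-homomorphism `f` with `f (f x) = x`. -/
structure AntiInvolution (Γ : Type*) [Group Γ] where
  toFun : Γ → Γ
  map_mul' : ∀ x y, toFun (x * y) = toFun y * toFun x
  involutive' : ∀ x, toFun (toFun x) = x

instance AntiInvolution.instCoeFun (Γ : Type*) [Group Γ] :
    CoeFun (AntiInvolution Γ) (fun _ => Γ → Γ) := ⟨AntiInvolution.toFun⟩

/-- The map `g x = x * f x` attached to an anti-involution `f`. -/
def AntiInvolution.g {Γ : Type*} [Group Γ] (f : AntiInvolution Γ) (x : Γ) : Γ := x * f x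

/-- A skew gain graph `(G, Γ, φ, f)` on the vertex set `V`. The skew gain function is defined on
all oriented edges (darts) of the simple graph `G`, and reversing an oriented edge applies `f`. -/
structure SkewGainGraph (V : Type*) (Γ : Type*) [Group Γ] where
  graph : SimpleGraph V
  f : AntiInvolution Γ
  φ : graph.Dart → Γ
  φ_symm : ∀ d : graph.Dart, φ d.symm = f (φ d)

namespace SkewGainGraph

/-- The value `g (φ e)` does not depend on the orientation of the edge `e`. -/
theorem g_φ_symm {V Γ : Type*} [CommGroup Γ] (Φ : SkewGainGraph V Γ) (d : Φ.graph.Dart) :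
    Φ.f.g (Φ.φ d.symm) = Φ.f.g (Φ.φ d) := by
  simp only [AntiInvolution.g, Φ.φ_symm, Φ.f.involutive', mul_comm]

/-- The gain of a walk: the product of the gains of its successive oriented edges. -/
def walkGain {V Γ : Type*} [Group Γ] (Φ : SkewGainGraph V Γ) {u v : V} (p : Φ.graph.Walk u v) : Γ :=
  (p.darts.map Φ.φ).prod

section Field

variable {V F : Type*} [Field F]

/-- `r` selects, for every edge `e`, a square root `√(g (φ e))` in the algebraic closure of `F`.
(The values of `r` off the edge set play no role.) -/
def IsSqrtChoice (Φ : SkewGainGraph V Fˣ) (r : Sym2 V → AlgebraicClosure F) : Prop :=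
  ∀ d : Φ.graph.Dart,
    r d.edge ^ 2 = algebraMap F (AlgebraicClosure F) ((Φ.f.g (Φ.φ d) : Fˣ) : F)

open Classical in
/-- The adjacency matrix: entry `φ (uv)` if `u ∼ v`, and `0` otherwise. -/
noncomputable def adjMatrix (Φ : SkewGainGraph V Fˣ) : Matrix V V F :=
  Matrix.of fun u v => if h : Φ.graph.Adj u v then ((Φ.φ ⟨(u, v), h⟩ : Fˣ) : F) else 0

open Classical in
/-- The `g`-degree matrix: the diagonal matrix whose entry at `v` is the sum of the selected roots
`√(g (φ e))` over the edges `e` incident with `v`. -/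
noncomputable def gDegreeMatrix [Fintype V] (Φ : SkewGainGraph V Fˣ)
    (r : Sym2 V → AlgebraicClosure F) : Matrix V V (AlgebraicClosure F) :=
  Matrix.diagonal fun v => ∑ e ∈ Φ.graph.edgeFinset with v ∈ e, r e

/-- The `g`-Laplacian matrix `L_g = D_g - A`. -/
noncomputable def gLaplacian [Fintype V] (Φ : SkewGainGraph V Fˣ)
    (r : Sym2 V → AlgebraicClosure F) : Matrix V V (AlgebraicClosure F) :=
  Φ.gDegreeMatrix r - Φ.adjMatrix.map (algebraMap F (AlgebraicClosure F))

end Field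

end SkewGainGraph

namespace SimpleGraph

/-- A graph is unicyclic if it has exactly one cycle, cycles being identified with their edge
sets (so that neither the starting vertex nor the direction of traversal matters). -/
def IsUnicyclic {V : Type*} (H : SimpleGraph V) : Prop :=
  ∃! S : Set (Sym2 V), ∃ (u : V) (p : H.Walk u u), p.IsCycle ∧ S = {e | e ∈ p.edges}

/-- A `1`-tree is a connected unicyclic graph. -/
def IsOneTree {V : Type*} (H : SimpleGraph V) : Prop :=
  H.Connected ∧ H.IsUnicyclic

/-- A `1`-forest is a disjoint union of `1`-trees: every component is a `1`-tree. -/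
def IsOneForest {V : Type*} (H : SimpleGraph V) : Prop :=
  ∀ ψ : H.ConnectedComponent, ψ.toSimpleGraph.IsOneTree

/-- The essential spanning subgraphs of `G`: the spanning subgraphs of `G` that are `1`-forests. -/
def EssentialSpanningSubgraph {V : Type*} (G : SimpleGraph V) : Type _ :=
  {Ψ : SimpleGraph V // Ψ ≤ G ∧ Ψ.IsOneForest}

noncomputable instance EssentialSpanningSubgraph.instFintype {V : Type*} [Finite V]
    (G : SimpleGraph V) : Fintype (EssentialSpanningSubgraph G) :=
  @Fintype.ofFinite _ (inferInstanceAs (Finite {Ψ : SimpleGraph V // Ψ ≤ G ∧ Ψ.IsOneForest}))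

noncomputable instance ConnectedComponent.instFintypeOfFinite {V : Type*} [Finite V]
    (H : SimpleGraph V) : Fintype H.ConnectedComponent :=
  @Fintype.ofFinite _ (inferInstanceAs (Finite (Quot H.Reachable)))

/-- A closed walk that traverses a cycle lying in the connected component `ψ`. In a `1`-tree
component it traverses the unique cycle, from some vertex and in some direction. -/
structure ComponentCycle {V : Type*} {H : SimpleGraph V} (ψ : H.ConnectedComponent) where
  base : V
  walk : H.Walk base base
  isCycle : walk.IsCycle
  base_mem : base ∈ ψ.supp

open Classical in
/-- The edges of the connected component `ψ`. -/
noncomputable def ConnectedComponent.edges {V : Type*} [Fintype V] {H : SimpleGraph V}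
    (ψ : H.ConnectedComponent) : Finset (Sym2 V) :=
  {e ∈ H.edgeFinset | ∀ v ∈ e, v ∈ ψ.supp}

end SimpleGraph

open Classical in
/-- The factor contributed by a component `ψ` with cycle `C` of a spanning subgraph `Ψ`:
`√(∏_{e ∉ C} g (φ e)) * (2 √(∏_{e ∈ C} g (φ e)) - (φ C + f (φ C)))`, `e` ranging over the edges
of `ψ`. The root of a product of values `g (φ e)` is the product of the roots selected by `r`. -/
noncomputable def SkewGainGraph.oneTreeFactor {V F : Type*} [Fintype V] [Field F]
    (Φ : SkewGainGraph V Fˣ) (r : Sym2 V → AlgebraicClosure F) {Ψ : SimpleGraph V}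
    (hΨ : Ψ ≤ Φ.graph) (ψ : Ψ.ConnectedComponent) (C : SimpleGraph.ComponentCycle ψ) :
    AlgebraicClosure F :=
  (∏ e ∈ ψ.edges with e ∉ C.walk.edges, r e) *
    (2 * (∏ e ∈ ψ.edges with e ∈ C.walk.edges, r e) -
      algebraMap F (AlgebraicClosure F)
        ((Φ.walkGain (C.walk.mapLe hΨ) : F) + (Φ.f (Φ.walkGain (C.walk.mapLe hΨ)) : F)))

/-- A choice of square roots always exists. -/
theorem SkewGainGraph.exists_isSqrtChoice {V F : Type*} [Field F] (Φ : SkewGainGraph V Fˣ) : ∃ r, Φ.IsSqrtChoice r := by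
  have key : ∀ e : Sym2 V, ∃ z : AlgebraicClosure F, ∀ d : Φ.graph.Dart, d.edge = e →
      z ^ 2 = algebraMap F (AlgebraicClosure F) ((Φ.f.g (Φ.φ d) : Fˣ) : F) := by
    intro e
    by_cases h : ∃ d : Φ.graph.Dart, d.edge = e
    · obtain ⟨d, rfl⟩ := h
      obtain ⟨z, hz⟩ := IsAlgClosed.exists_pow_nat_eq
        (algebraMap F (AlgebraicClosure F) ((Φ.f.g (Φ.φ d) : Fˣ) : F)) (n := 2) (by norm_num)
      refine ⟨z, fun d' hd' => ?_⟩
      rcases (SimpleGraph.dart_edge_eq_iff d' d).1 hd' with rfl | rfl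
      · exact hz
      · rw [hz, Φ.g_φ_symm]
    · exact ⟨0, fun d hd => (h ⟨d, hd⟩).elim⟩
  choose r hr using key
  exact ⟨r, fun d => hr _ d rfl⟩

/-- Every component of a `1`-forest has a traversal of its cycle. -/
theorem SimpleGraph.IsOneForest.nonempty_componentCycle {V : Type*} {H : SimpleGraph V} (h : H.IsOneForest) (ψ : H.ConnectedComponent) :
    Nonempty (SimpleGraph.ComponentCycle ψ) := by
  obtain ⟨S, ⟨u, p, hp, -⟩, -⟩ := (h ψ).2
  exact ⟨⟨u.1, p.map ψ.toSimpleGraph_hom, hp.map Subtype.val_injective, u.2⟩⟩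

/-! Row `v` of the `g`-Laplacian is the sum, over the neighbours `w` of `v`, of `√g(φ(vw)) e_v -
φ(vw) e_w`. By multilinearity the determinant is a sum over self-maps `s` of the vertex set, `s v`
being the neighbour chosen at `v` (`det_gLaplacian_eq_sum`). A non-adjacent choice gives a zero row.
If `s` has a 2-cycle `v, w`, the two rows are proportional because `g(φ(vw)) = φ(vw) φ(wv)`, so the
term vanishes.

The remaining `s` orient the graph with edges `{v, s v}`, which has one edge for each vertex and is
a 1-forest. The determinant of the term factors over components; in each block only the identity and
the rotation of the cycle survive in the Leibniz formula (`det_ofMap_of_unique_cycle`), which gives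
the roots off the cycle times (product of the roots on the cycle minus the gain of the oriented
cycle).

Conversely, in an orientation of a 1-forest every edge off the cycles points towards its cycle, and
each cycle is oriented in one of two ways, independently (`IsOneForest.existsUnique_orients`).
Reversing a cycle replaces its gain by the `f`-image, so adding the two directions yields `2√∏g -
(φ(C) + f(φ(C)))`. -/

namespace SimpleGraph

variable {V : Type*}

/-- The self-map `s` orients the graph `H`: it has no `2`-cycle, and the edges of `H` are exactly
the pairs `{v, s v}`. -/
def Orients (s : V → V) (H : SimpleGraph V) : Prop :=
  (∀ v, s (s v) ≠ v) ∧ ∀ u v, H.Adj u v ↔ s u = v ∨ s v = u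

/-! ### Indexing the vertices of closed walks -/

namespace Walk

variable {H : SimpleGraph V} {u : V}

theorem getVert_length_eq_getVert_zero (p : H.Walk u u) : p.getVert p.length = p.getVert 0 := by
  rw [getVert_length, getVert_zero]

theorem mem_support_iff_exists_getVert_lt {p : H.Walk u u} (hp : 0 < p.length) {v : V} :
    v ∈ p.support ↔ ∃ i < p.length, p.getVert i = v := by
  rw [mem_support_iff_exists_getVert]
  constructor
  · rintro ⟨i, rfl, hi⟩
    rcases hi.lt_or_eq with hi | rfl
    · exact ⟨i, hi, rfl⟩
    · exact ⟨0, hp, p.getVert_length_eq_getVert_zero.symm⟩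
  · rintro ⟨i, hi, rfl⟩
    exact ⟨i, rfl, hi.le⟩

theorem mem_support_iff_exists_getVert_succ {p : H.Walk u u} (hp : 0 < p.length) {v : V} :
    v ∈ p.support ↔ ∃ i < p.length, p.getVert (i + 1) = v := by
  rw [mem_support_iff_exists_getVert_lt hp]
  constructor
  · rintro ⟨i, hi, rfl⟩
    rcases i with _ | i
    · exact ⟨p.length - 1, by omega, by
        rw [Nat.sub_add_cancel (by omega), p.getVert_length_eq_getVert_zero]⟩
    · exact ⟨i, by omega, rfl⟩
  · rintro ⟨i, hi, rfl⟩
    rcases Nat.lt_or_ge (i + 1) p.length with h | h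
    · exact ⟨i + 1, h, rfl⟩
    · exact ⟨0, hp, by rw [← p.getVert_length_eq_getVert_zero]; congr 1; omega⟩

theorem mk_getVert_mem_edges (p : H.Walk u u) {i : ℕ} (hi : i < p.length) :
    s(p.getVert i, p.getVert (i + 1)) ∈ p.edges :=
  (p.mk_mem_edges_iff_exists).2 ⟨i, hi, rfl⟩

end Walk

/-! ### Cycles of an oriented graph -/

namespace Orients

variable {s : V → V} {H : SimpleGraph V}

theorem adj (h : Orients s H) (v : V) : H.Adj v (s v) := (h.2 _ _).2 (Or.inl rfl)

theorem edge_injective (h : Orients s H) : Function.Injective fun v => s(v, s v) := by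
  intro v w hvw
  rcases Sym2.eq_iff.1 hvw with ⟨h1, -⟩ | ⟨h1, h2⟩
  · exact h1
  · exact absurd (by rw [h2, ← h1] : s (s v) = v) (h.1 v)

theorem exists_edge_eq (h : Orients s H) {e : Sym2 V} (he : e ∈ H.edgeSet) :
    ∃ v, s(v, s v) = e := by
  induction e with | h u v =>
  rcases (h.2 u v).1 he with rfl | rfl
  · exact ⟨u, rfl⟩
  · exact ⟨v, Sym2.eq_swap⟩

/-- Once an oriented cycle is followed backwards, it is followed backwards ever after. -/
theorem back_of_back (h : Orients s H) {u : V} {p : H.Walk u u} (hp : p.IsCycle) {i j : ℕ}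
    (hij : i ≤ j) (hj : j < p.length) (hi : s (p.getVert (i + 1)) = p.getVert i) :
    s (p.getVert (j + 1)) = p.getVert j := by
  induction j, hij using Nat.le_induction with
  | base => exact hi
  | succ j hij ih =>
    have ih := ih (by omega)
    rcases (h.2 _ _).1 (p.adj_getVert_succ hj) with h1 | h1
    · rw [ih] at h1
      have h3 := hp.three_le_length
      -- Turning forward here would make vertices `j` and `j + 2` equal. Injectivity holds for
      -- indices from `1` to the length, so index `0` is first replaced by the length.
      by_cases hj0 : j = 0
      · subst hj0
        rw [← p.getVert_length_eq_getVert_zero] at h1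
        have := hp.getVert_injOn (by simp only [Set.mem_ofPred_eq]; omega)
          (by simp only [Set.mem_ofPred_eq]; omega) h1
        omega
      · have := hp.getVert_injOn (by simp only [Set.mem_ofPred_eq]; omega)
          (by simp only [Set.mem_ofPred_eq]; omega) h1
        omega
    · exact h1

/-- A single backward edge would force the last edge to be backward, so the base vertex would be
sent to its predecessor as well as its successor; these differ in a cycle of length at least `3`. -/
theorem forward (h : Orients s H) {u : V} {p : H.Walk u u} (hp : p.IsCycle)
    (h0 : s (p.getVert 0) = p.getVert 1) {i : ℕ} (hi : i < p.length) :
    s (p.getVert i) = p.getVert (i + 1) := by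
  have h3 := hp.three_le_length
  rcases (h.2 _ _).1 (p.adj_getVert_succ hi) with h1 | h1
  · exact h1
  · have h2 := h.back_of_back hp (j := p.length - 1) (by omega) (by omega) h1
    rw [Nat.sub_add_cancel (by omega), p.getVert_length_eq_getVert_zero, h0] at h2
    have := hp.getVert_injOn (by simp only [Set.mem_ofPred_eq]; omega)
      (by simp only [Set.mem_ofPred_eq]; omega) h2
    omega

theorem backward (h : Orients s H) {u : V} {p : H.Walk u u} (hp : p.IsCycle)
    (h0 : s (p.getVert 0) ≠ p.getVert 1) {i : ℕ} (hi : i < p.length) :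
    s (p.getVert (i + 1)) = p.getVert i := by
  have h3 := hp.three_le_length
  refine h.back_of_back hp (Nat.zero_le i) hi ?_
  exact ((h.2 _ _).1 (p.adj_getVert_succ (by omega : 0 < p.length))).resolve_left h0

theorem exists_iterate_eq_of_reachable (h : Orients s H) {u v : V} (huv : H.Reachable u v) :
    ∃ m n : ℕ, s^[m] u = s^[n] v := by
  obtain ⟨p⟩ := huv
  induction p with
  | nil => exact ⟨0, 0, rfl⟩
  | @cons u v w hadj p ih =>
    obtain ⟨m, n, hmn⟩ := ih
    rcases (h.2 _ _).1 hadj with rfl | rfl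
    · exact ⟨m + 1, n, by rw [Function.iterate_succ_apply, hmn]⟩
    · exact ⟨m, n + 1, by
        rw [← Function.iterate_succ_apply, Function.iterate_succ_apply', hmn,
          Function.iterate_succ_apply']⟩

/-- The vertices of a cycle form the forward orbit of each of them. -/
theorem mem_support_iff (h : Orients s H) {u : V} {p : H.Walk u u} (hp : p.IsCycle) {v : V}
    (hv : v ∈ p.support) (w : V) : w ∈ p.support ↔ ∃ n, s^[n] v = w := by
  have h3 := hp.three_le_length
  have key : ∀ v ∈ p.support, s v ∈ p.support ∧ ∃ n, s^[n] u = v := by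
    by_cases h0 : s (p.getVert 0) = p.getVert 1
    · have hf := fun i hi => h.forward hp h0 (i := i) hi
      have hn : ∀ i ≤ p.length, s^[i] u = p.getVert i := by
        intro i hi
        induction i with
        | zero => simp
        | succ i ih => rw [Function.iterate_succ_apply', ih (by omega), hf i (by omega)]
      intro v hv
      obtain ⟨i, hi, rfl⟩ := (Walk.mem_support_iff_exists_getVert_lt (by omega)).1 hv
      exact ⟨hf i hi ▸ p.getVert_mem_support _, i, hn i hi.le⟩
    · have hf := fun i hi => h.backward hp h0 (i := i) hi
      have hn : ∀ i ≤ p.length, s^[i] u = p.getVert (p.length - i) := by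
        intro i hi
        induction i with
        | zero => simp
        | succ i ih =>
          rw [Function.iterate_succ_apply', ih (by omega), ← hf (p.length - (i + 1)) (by omega)]
          congr 2
          omega
      intro v hv
      obtain ⟨i, hi, rfl⟩ := (Walk.mem_support_iff_exists_getVert_succ (by omega)).1 hv
      refine ⟨hf i hi ▸ p.getVert_mem_support _, p.length - (i + 1), ?_⟩
      rw [hn _ (by omega)]
      congr 1
      omega
  have hit : ∀ n, ∀ v ∈ p.support, s^[n] v ∈ p.support := by
    intro n
    induction n with
    | zero => exact fun v hv => hv
    | succ n ih =>
      intro v hv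
      rw [Function.iterate_succ_apply]
      exact ih _ (key v hv).1
  have hper : ∃ k, 0 < k ∧ s^[k] u = u := by
    by_cases h0 : s (p.getVert 0) = p.getVert 1
    · refine ⟨p.length, by omega, ?_⟩
      have hn : ∀ i ≤ p.length, s^[i] u = p.getVert i := by
        intro i hi
        induction i with
        | zero => simp
        | succ i ih =>
          rw [Function.iterate_succ_apply', ih (by omega), h.forward hp h0 (by omega)]
      rw [hn _ le_rfl, p.getVert_length]
    · obtain ⟨n, hn⟩ := (key (p.getVert 1) (p.getVert_mem_support _)).2
      refine ⟨n + 1, by omega, ?_⟩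
      rw [Function.iterate_succ_apply', hn]
      simpa using h.backward hp h0 (i := 0) (by omega)
  constructor
  · intro hw
    obtain ⟨m, rfl⟩ := (key w hw).2
    obtain ⟨n, rfl⟩ := (key v hv).2
    obtain ⟨k, hk, hku⟩ := hper
    have hmul : ∀ j, s^[k * j] u = u := by
      intro j
      rw [Function.iterate_mul]
      exact Function.iterate_fixed hku j
    -- From `v = s^[n] u`, another `k * n - n` steps complete `n` periods and return to `u`; then
    -- `m` steps lead to `w`.
    refine ⟨k * n - n + m, ?_⟩
    rw [← Function.iterate_add_apply]
    have : k * n - n + m + n = m + k * n := by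
      have : n ≤ k * n := Nat.le_mul_of_pos_left n hk
      omega
    rw [this, Function.iterate_add_apply, hmul]
  · rintro ⟨n, rfl⟩
    exact hit n v hv

/-- Each cycle vertex is the tail of the cycle edge leaving it, in whichever direction `s` runs.
This turns products over cycle edges into products over cycle vertices. -/
theorem edge_mem_edges_iff (h : Orients s H) {u : V} {p : H.Walk u u} (hp : p.IsCycle) (v : V) :
    s(v, s v) ∈ p.edges ↔ v ∈ p.support := by
  refine ⟨p.fst_mem_support_of_mem_edges, fun hv => ?_⟩
  have h3 := hp.three_le_length
  by_cases h0 : s (p.getVert 0) = p.getVert 1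
  · obtain ⟨i, hi, rfl⟩ := (Walk.mem_support_iff_exists_getVert_lt (by omega)).1 hv
    rw [h.forward hp h0 hi]
    exact p.mk_getVert_mem_edges hi
  · obtain ⟨i, hi, rfl⟩ := (Walk.mem_support_iff_exists_getVert_succ (by omega)).1 hv
    rw [h.backward hp h0 hi, Sym2.eq_swap]
    exact p.mk_getVert_mem_edges hi

theorem exists_iterate_mem_support (h : Orients s H) {u : V} {p : H.Walk u u} (hp : p.IsCycle)
    {v : V} (hv : H.Reachable v u) : ∃ n, s^[n] v ∈ p.support := by
  obtain ⟨m, n, hmn⟩ := h.exists_iterate_eq_of_reachable hv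
  exact ⟨m, (h.mem_support_iff hp p.start_mem_support _).2 ⟨n, hmn.symm⟩⟩

/-- The injection `v ↦ {v, s v}` gives at least as many edges as vertices, so there is a cycle.
Forward orbits starting on a second cycle enter the first, so the two share a vertex; both vertex
sets are the orbit of that vertex, and the edges follow. -/
theorem isOneTree [Finite V] (h : Orients s H) (hc : H.Connected) : H.IsOneTree := by
  classical
  refine ⟨hc, ?_⟩
  have hne : ¬ H.IsAcyclic := by
    intro hac
    have := Fintype.ofFinite V
    have h1 := (IsTree.mk hc hac).card_edgeFinset
    have h2 : Fintype.card V ≤ H.edgeFinset.card :=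
      Finset.card_le_card_of_injOn (fun v => s(v, s v)) (fun v _ => by simpa using h.adj v)
        h.edge_injective.injOn
    omega
  simp only [IsAcyclic, not_forall, not_not] at hne
  obtain ⟨u, p, hp⟩ := hne
  refine ⟨_, ⟨u, p, hp, rfl⟩, ?_⟩
  rintro _ ⟨v, q, hq, rfl⟩
  have hsup : ∀ w, w ∈ q.support ↔ w ∈ p.support := by
    obtain ⟨n, hn⟩ := h.exists_iterate_mem_support hp (hc v u)
    have hn' := (h.mem_support_iff hq q.start_mem_support _).2 ⟨n, rfl⟩
    intro w
    rw [h.mem_support_iff hq hn', h.mem_support_iff hp hn]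
  ext e
  constructor
  · intro he
    obtain ⟨w, rfl⟩ := h.exists_edge_eq (q.edges_subset_edgeSet he)
    exact (h.edge_mem_edges_iff hp w).2 ((hsup w).1 ((h.edge_mem_edges_iff hq w).1 he))
  · intro he
    obtain ⟨w, rfl⟩ := h.exists_edge_eq (p.edges_subset_edgeSet he)
    exact (h.edge_mem_edges_iff hq w).2 ((hsup w).2 ((h.edge_mem_edges_iff hp w).1 he))

end Orients

/-! ### Orientations of a 1-tree -/

theorem Connected.exists_adj_dist_add_one_eq {H : SimpleGraph V} (hc : H.Connected) {x v : V}
    (hv : v ≠ x) : ∃ w, H.Adj v w ∧ H.dist w x + 1 = H.dist v x := by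
  obtain ⟨p, hp⟩ := hc.exists_walk_length_eq_dist v x
  cases p with
  | nil => exact absurd rfl hv
  | @cons _ w _ hadj q =>
    refine ⟨w, hadj, ?_⟩
    rw [Walk.length_cons] at hp
    have h1 := dist_le q
    have h2 := hc.dist_triangle (u := v) (v := w) (w := x)
    rw [dist_eq_one_iff_adj.2 hadj] at h2
    omega

/-- Both neighbours extend to shortest paths from `u` to `x`, and a tree has only one path between
them. -/
theorem IsTree.eq_of_dist_add_one_eq {T : SimpleGraph V} (hT : T.IsTree) {x u v w : V}
    (hv : T.Adj u v) (hw : T.Adj u w) (hdv : T.dist v x + 1 = T.dist u x)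
    (hdw : T.dist w x + 1 = T.dist u x) : v = w := by
  obtain ⟨p, hp⟩ := hT.1.exists_walk_length_eq_dist v x
  obtain ⟨q, hq⟩ := hT.1.exists_walk_length_eq_dist w x
  have hp' : (Walk.cons hv p).IsPath :=
    Walk.isPath_of_length_eq_dist _ (by rw [Walk.length_cons, hp, hdv])
  have hq' : (Walk.cons hw q).IsPath :=
    Walk.isPath_of_length_eq_dist _ (by rw [Walk.length_cons, hq, hdw])
  have := congrArg Walk.snd ((hT.existsUnique_path u x).unique hp' hq')
  simpa using this

/-- An edge on a cycle is not a bridge, and a cycle surviving the deletion would be the unique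
cycle, which contains the deleted edge. -/
theorem IsOneTree.isTree_deleteEdges {H : SimpleGraph V} (hH : H.IsOneTree) {u x y : V}
    {p : H.Walk u u} (hp : p.IsCycle) (hxy : s(x, y) ∈ p.edges) :
    (H.deleteEdges {s(x, y)}).IsTree := by
  refine ⟨hH.1.connected_delete_edge_of_not_isBridge fun hb => hb.notMem_edges_of_isCycle hp hxy,
    fun v q hq => ?_⟩
  have h1 := hH.2.unique ⟨u, p, hp, rfl⟩ ⟨v, q.mapLe (deleteEdges_le _), hq.mapLe _, rfl⟩
  have h2 : s(x, y) ∈ (q.mapLe (deleteEdges_le {s(x, y)})).edges := (Set.ext_iff.1 h1 _).1 hxy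
  rw [Walk.edges_mapLe_eq_edges] at h2
  simpa using q.edges_subset_edgeSet h2

/-- A `1`-tree has exactly one orientation that extends a given orientation of an edge of its
cycle. -/
theorem IsOneTree.existsUnique_orients {H : SimpleGraph V} (hH : H.IsOneTree) {u x y : V}
    {p : H.Walk u u} (hp : p.IsCycle) (hxy : s(x, y) ∈ p.edges) :
    ∃! s : V → V, Orients s H ∧ s x = y := by
  classical
  have hT := hH.isTree_deleteEdges hp hxy
  set T := H.deleteEdges {s(x, y)} with hTdef
  have hadj : H.Adj x y := p.edges_subset_edgeSet hxy
  have hTadj : ∀ a b, T.Adj a b ↔ H.Adj a b ∧ s(a, b) ≠ s(x, y) := fun a b => by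
    simp [hTdef, deleteEdges_adj]
  -- Root the tree `T` at `x`: `t v` is the parent of `v`. The orientation sends `x` to `y` and
  -- every other vertex to its parent.
  choose! t ht using fun v (hv : v ≠ x) => hT.1.exists_adj_dist_add_one_eq hv
  refine existsUnique_of_exists_of_unique
    ⟨fun v => if v = x then y else t v, ⟨fun v => ?_, fun a b => ⟨fun hab => ?_, ?_⟩⟩, by simp⟩ ?_
  · by_cases hv : v = x
    · subst hv
      have hyv : y ≠ v := hadj.ne'
      simp only [if_true, hyv, if_false]
      intro h
      have := ((hTadj _ _).1 (ht y hyv).1).2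
      rw [h, Sym2.eq_swap] at this
      exact this rfl
    · simp only [hv, if_false]
      split_ifs with h
      · rintro rfl
        have := ((hTadj _ _).1 (ht y hv).1).2
        rw [h, Sym2.eq_swap] at this
        exact this rfl
      · intro h'
        have h1 := (ht v hv).2
        have h2 := (ht _ h).2
        rw [h'] at h2
        omega
  · have key : ∀ a b, T.Adj a b → T.dist x a = T.dist x b + 1 →
        (if a = x then y else t a) = b := by
      intro a b hab hd
      have hax : a ≠ x := by
        rintro rfl
        simp at hd
      rw [if_neg hax]
      exact hT.eq_of_dist_add_one_eq (ht a hax).1 hab (ht a hax).2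
        (by rw [dist_comm, ← hd, dist_comm])
    by_cases he : s(a, b) = s(x, y)
    · rcases Sym2.eq_iff.1 he with ⟨rfl, rfl⟩ | ⟨rfl, rfl⟩
      · left; simp
      · right; simp
    · have hab' := (hTadj a b).2 ⟨hab, he⟩
      rcases hT.dist_eq_dist_add_one_of_adj x hab' with h | h
      · exact Or.inl (key a b hab' h)
      · exact Or.inr (key b a hab'.symm h)
  · have key : ∀ a, H.Adj a (if a = x then y else t a) := by
      intro a
      split_ifs with h
      · exact h ▸ hadj
      · exact ((hTadj _ _).1 (ht a h).1).1
    rintro (h | h)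
    · exact h ▸ key a
    · exact h ▸ (key b).symm
  · have key : ∀ s : V → V, Orients s H → s x = y → ∀ n, ∀ v, T.dist v x = n → v ≠ x →
        s v = t v := by
      intro s hs hsx n
      induction n using Nat.strong_induction_on with | _ n ih =>
      intro v hn hv
      obtain ⟨h1, h2⟩ := ht v hv
      obtain ⟨h3, h4⟩ := (hTadj _ _).1 h1
      -- If `s` sent the parent back to `v`, a parent equal to `x` would make the edge the deleted
      -- one; any other parent is sent towards `x` by induction, whereas `v` is farther away.
      refine ((hs.2 _ _).1 h3).resolve_right fun h5 => ?_
      by_cases hw : t v = x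
      · rw [hw, hsx] at h5
        rw [hw, ← h5, Sym2.eq_swap] at h4
        exact h4 rfl
      · have h6 := ih (T.dist (t v) x) (by omega) _ rfl hw
        have h7 := (ht _ hw).2
        rw [← h6, h5] at h7
        omega
    rintro s s' ⟨hs, hsx⟩ ⟨hs', hsx'⟩
    funext v
    by_cases hv : v = x
    · rw [hv, hsx, hsx']
    · rw [key s hs hsx _ v rfl hv, key s' hs' hsx' _ v rfl hv]

end SimpleGraph

/-! ### Orientations of a 1-forest, component by component -/

namespace SimpleGraph

variable {V : Type*} {s : V → V} {H : SimpleGraph V}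

namespace Orients

theorem connectedComponentMk_apply (h : Orients s H) (v : V) :
    H.connectedComponentMk (s v) = H.connectedComponentMk v :=
  ConnectedComponent.sound (h.adj v).symm.reachable

theorem mem_component (h : Orients s H) {ψ : H.ConnectedComponent} {v : V} (hv : v ∈ ψ) :
    s v ∈ ψ :=
  (h.connectedComponentMk_apply v).trans hv

theorem restrict (h : Orients s H) (ψ : H.ConnectedComponent) :
    Orients (fun v : ψ => ⟨s v, h.mem_component v.2⟩) ψ.toSimpleGraph :=
  ⟨fun v hv => h.1 v.1 (congrArg Subtype.val hv), fun u v => by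
    rw [ψ.toSimpleGraph_adj u.2 v.2, h.2, Subtype.ext_iff, Subtype.ext_iff]⟩

theorem isOneForest [Finite V] (h : Orients s H) : H.IsOneForest := fun ψ =>
  (h.restrict ψ).isOneTree ψ.connected_toSimpleGraph

end Orients

namespace ComponentCycle

variable {ψ : H.ConnectedComponent}

theorem length_pos (C : ComponentCycle ψ) : 0 < C.walk.length := by
  have := C.isCycle.three_le_length
  omega

theorem mem_of_mem_support (C : ComponentCycle ψ) {v : V} (hv : v ∈ C.walk.support) : v ∈ ψ := by
  classical
  exact (ConnectedComponent.sound (C.walk.takeUntil v hv).reachable).symm.trans C.base_mem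

/-- The first vertex of the cycle. -/
def first (C : ComponentCycle ψ) : ψ :=
  ⟨C.walk.getVert 0, C.mem_of_mem_support (C.walk.getVert_mem_support _)⟩

/-- The second vertex of the cycle. -/
def second (C : ComponentCycle ψ) : ψ :=
  ⟨C.walk.getVert 1, C.mem_of_mem_support (C.walk.getVert_mem_support _)⟩

/-- Transfers the cycle to the graph induced on its component, where the 1-tree results apply. Its
first edge serves to record the direction. -/
theorem exists_isCycle (C : ComponentCycle ψ) :
    ∃ (u : ψ) (p : ψ.toSimpleGraph.Walk u u), p.IsCycle ∧ s(C.first, C.second) ∈ p.edges := by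
  have hw : ∀ v ∈ C.walk.support, v ∈ ψ.supp := fun v hv => C.mem_of_mem_support hv
  have hmap := C.walk.map_induce hw
  have hcyc : ((C.walk.induce ψ.supp hw).map (Embedding.induce ψ.supp).toHom).IsCycle :=
    (congrArg (fun w : H.Walk C.base C.base => w.IsCycle) hmap).mpr C.isCycle
  have hedges : (C.walk.induce ψ.supp hw).edges.map (Sym2.map Subtype.val) = C.walk.edges :=
    (Walk.edges_map _ _).symm.trans
      (congrArg (fun w : H.Walk C.base C.base => w.edges) hmap)
  refine ⟨_, C.walk.induce ψ.supp hw, hcyc.of_map, ?_⟩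
  have h := C.walk.mk_getVert_mem_edges C.length_pos
  rw [← hedges, List.mem_map] at h
  obtain ⟨e, he, h⟩ := h
  have : e = s(C.first, C.second) := Sym2.map.injective Subtype.val_injective h
  exact this ▸ he

end ComponentCycle

/-- A `1`-forest has exactly one orientation with prescribed orientations of its cycles. -/
theorem IsOneForest.existsUnique_orients (hH : H.IsOneForest)
    (C : ∀ ψ : H.ConnectedComponent, ComponentCycle ψ) (o : H.ConnectedComponent → Bool) :
    ∃! s : V → V, Orients s H ∧ ∀ ψ, s (C ψ).first = (C ψ).second ↔ o ψ = true := by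
  classical
  have key : ∀ ψ : H.ConnectedComponent, ∃! t : ψ → ψ, Orients t ψ.toSimpleGraph ∧
      (t (C ψ).first = (C ψ).second ↔ o ψ = true) := by
    intro ψ
    obtain ⟨u, p, hp, hmem⟩ := (C ψ).exists_isCycle
    cases ho : o ψ with
    | true => simpa using (hH ψ).existsUnique_orients hp hmem
    | false =>
      have hadj := p.edges_subset_edgeSet hmem
      -- Not sending the first vertex to the second means sending the second to the first, so the
      -- 1-tree result applies to the reversed edge.
      rw [Sym2.eq_swap] at hmem
      have := (hH ψ).existsUnique_orients hp hmem
      refine (existsUnique_congr fun t => and_congr_right fun ht => ?_).2 this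
      simp only [Bool.false_eq_true, iff_false]
      exact ⟨((ht.2 _ _).1 hadj).resolve_left, fun h1 h2 => ht.1 _ (by rw [h2, h1])⟩
  choose t ht htu using fun ψ => key ψ
  refine ⟨fun v => t (H.connectedComponentMk v) ⟨v, rfl⟩, ⟨⟨fun v hv => ?_, fun u v => ?_⟩,
    fun ψ => ?_⟩, ?_⟩
  all_goals
    have hval : ∀ (ψ : H.ConnectedComponent) (v : V) (hv : v ∈ ψ),
      (t (H.connectedComponentMk v) ⟨v, rfl⟩ : V) = t ψ ⟨v, hv⟩ := by rintro _ v rfl; rfl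
  · change (t (H.connectedComponentMk _) ⟨_, rfl⟩ : V) = v at hv
    rw [hval (H.connectedComponentMk v) _ (Subtype.mem _)] at hv
    exact (ht (H.connectedComponentMk v)).1.1 ⟨v, rfl⟩ (Subtype.ext hv)
  · change H.Adj u v ↔ (t (H.connectedComponentMk u) ⟨u, rfl⟩ : V) = v ∨
      (t (H.connectedComponentMk v) ⟨v, rfl⟩ : V) = u
    by_cases huv : v ∈ H.connectedComponentMk u
    · rw [hval _ v huv, ← ConnectedComponent.toSimpleGraph_adj (H.connectedComponentMk u) rfl huv,
        (ht _).1.2, Subtype.ext_iff, Subtype.ext_iff]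
    · have h1 : ¬ H.Adj u v := fun h => huv (ConnectedComponent.sound h.symm.reachable)
      refine iff_of_false h1 ?_
      rintro (h | h)
      · exact huv (h ▸ Subtype.mem _)
      · have := (t (H.connectedComponentMk v) ⟨v, rfl⟩).2
        rw [h] at this
        exact huv (Eq.symm this)
  · change (t (H.connectedComponentMk _) ⟨_, rfl⟩ : V) = _ ↔ _
    rw [hval ψ _ (C ψ).first.2, ← (ht ψ).2, Subtype.ext_iff]
  · rintro s ⟨hs, hso⟩
    funext v
    have := htu (H.connectedComponentMk v) _ ⟨hs.restrict _, by
      rw [← hso, Subtype.ext_iff]⟩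
    rw [← this]

/-- Orientations correspond bijectively to Boolean families on the components, so the sum is the
expansion of a product of two-term sums. -/
theorem IsOneForest.sum_orients [Fintype V] [DecidableEq V] {R : Type*} [CommSemiring R]
    (hH : H.IsOneForest) (C : ∀ ψ : H.ConnectedComponent, ComponentCycle ψ)
    (t : H.ConnectedComponent → Bool → R) [DecidablePred fun s : V → V => Orients s H] :
    ∑ s : V → V with Orients s H,
      ∏ ψ, t ψ (decide (s (C ψ).first = (C ψ).second)) = ∏ ψ, (t ψ true + t ψ false) := by
  classical
  simp_rw [← Fintype.sum_bool]
  rw [Finset.prod_univ_sum, Fintype.piFinset_univ]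
  refine Finset.sum_bij (fun s _ ψ => decide (s (C ψ).first = (C ψ).second)) (by simp) ?_ ?_
    (fun _ _ => rfl)
  · intro s hs s' hs' h
    refine (hH.existsUnique_orients C fun ψ => decide (s (C ψ).first = (C ψ).second)).unique
      ⟨(Finset.mem_filter.1 hs).2, fun ψ => by simp⟩ ⟨(Finset.mem_filter.1 hs').2, fun ψ => ?_⟩
    rw [congrFun h ψ]
    simp
  · intro o _
    obtain ⟨s, ⟨hs, hso⟩, -⟩ := hH.existsUnique_orients C o
    refine ⟨s, by simpa using hs, funext fun ψ => ?_⟩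
    rw [Bool.eq_iff_iff, decide_eq_true_iff, hso]

end SimpleGraph

/-! ### The determinant of a functional graph with one cycle -/

namespace Matrix

variable {W R : Type*} [DecidableEq W] [CommRing R]

/-- The matrix with rows `a v • e_v - b v • e_{s v}`. -/
def ofMap (s : W → W) (a b : W → R) : Matrix W W R :=
  of fun v => Pi.single v (a v) - Pi.single (s v) (b v)

theorem ofMap_apply (s : W → W) (a b : W → R) (v w : W) :
    ofMap s a b v w = (if w = v then a v else 0) - if w = s v then b v else 0 := by
  simp [ofMap, Pi.single_apply]

/-- The determinant of `ofMap s a b` if `P` is the only cycle of `s`. -/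
theorem det_ofMap_of_unique_cycle [Fintype W] {s : W → W} (hs : ∀ v, s v ≠ v) (a b : W → R)
    {P : Finset W} (hP0 : P.Nonempty) (hP : ∀ v ∈ P, ∀ w, w ∈ P ↔ ∃ n, s^[n] v = w)
    (hreach : ∀ v, ∃ n, s^[n] v ∈ P) :
    (ofMap s a b).det = (∏ v ∈ Pᶜ, a v) * (∏ v ∈ P, a v - ∏ v ∈ P, b v) := by
  have hsP : ∀ v ∈ P, s v ∈ P := fun v hv => (hP v hv _).2 ⟨1, rfl⟩
  have hsurj : Function.Surjective fun v => if v ∈ P then s v else v := by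
    intro v
    by_cases hv : v ∈ P
    · obtain ⟨n, hn⟩ := (hP _ (hsP v hv) v).1 hv
      refine ⟨s^[n] v, ?_⟩
      change (if s^[n] v ∈ P then s (s^[n] v) else s^[n] v) = v
      rw [if_pos ((hP v hv _).2 ⟨n, rfl⟩), ← Function.iterate_succ_apply' s,
        Function.iterate_succ_apply, hn]
    · exact ⟨v, if_neg hv⟩
  -- The rotation of the cycle: `s` on `P`, the identity elsewhere.
  let c : Equiv.Perm W := Equiv.ofBijective _ (Finite.surjective_iff_bijective.1 hsurj)
  have hc : ∀ v, c v = if v ∈ P then s v else v := fun _ => rfl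
  have hcP : ∀ v, c v ≠ v ↔ v ∈ P := by
    intro v
    rw [hc]
    split_ifs with h
    · simp [h, hs]
    · simp [h]
  have hsupp : c.support = P := by
    ext v
    rw [Equiv.Perm.mem_support, hcP]
  have hiter : ∀ n, ∀ v ∈ P, (c ^ n) v = s^[n] v := by
    intro n
    induction n with
    | zero => exact fun v _ => rfl
    | succ n ih =>
      intro v hv
      rw [pow_succ, Equiv.Perm.mul_apply, hc, if_pos hv, ih _ (hsP v hv),
        Function.iterate_succ_apply]
  have hcyc : c.IsCycle := by
    obtain ⟨v, hv⟩ := hP0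
    refine ⟨v, (hcP v).2 hv, fun w hw => ?_⟩
    obtain ⟨n, hn⟩ := (hP v hv w).1 ((hcP w).1 hw)
    exact ⟨n, by rw [zpow_natCast, hiter n v hv, hn]⟩
  have hsplit : ∀ f : W → R, (∏ v ∈ Pᶜ, f v) * ∏ v ∈ P, f v = ∏ v, f v := fun f =>
    Finset.prod_compl_mul_prod P f
  rw [← det_transpose, det_apply, Finset.sum_eq_add (1 : Equiv.Perm W) c]
  · have h1 : ∏ v, (ofMap s a b)ᵀ ((1 : Equiv.Perm W) v) v = ∏ v, a v := by
      refine Finset.prod_congr rfl fun v _ => ?_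
      simp [ofMap_apply, (hs v).symm]
    have h2 : ∏ v, (ofMap s a b)ᵀ (c v) v = (∏ v ∈ Pᶜ, a v) * ∏ v ∈ P, -b v := by
      rw [← hsplit]
      congr 1
      · refine Finset.prod_congr rfl fun v hv => ?_
        rw [Finset.mem_compl] at hv
        simp [ofMap_apply, hc, hv, (hs v).symm]
      · refine Finset.prod_congr rfl fun v hv => ?_
        simp [ofMap_apply, hc, hv, hs v]
    -- The sign `-(-1)^|P|` of the cycle and the factor `(-1)^|P|` from the entries `-b v` combine
    -- to `-1`.
    rw [h1, h2, hcyc.sign, hsupp, Finset.prod_neg, ← hsplit]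
    have h3 : ((-1 : R) ^ P.card) * (-1) ^ P.card = 1 := by
      rw [← mul_pow]; simp
    simp only [Equiv.Perm.sign_one, one_smul, Units.smul_def, zsmul_eq_mul]
    push_cast
    linear_combination (-(∏ v ∈ Pᶜ, a v) * ∏ v ∈ P, b v) * h3
  · exact hcyc.ne_one.symm
  · rintro σ - ⟨hσ1, hσc⟩
    by_contra hne
    have hM : ∀ v, σ v = v ∨ σ v = s v := by
      intro v
      by_contra! h
      refine hne ?_
      rw [Finset.prod_eq_zero (Finset.mem_univ v), smul_zero]
      simp [ofMap_apply, h.1, h.2]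
    -- In a nonzero term `σ` fixes each point or follows `s`. By injectivity a moved point has its
    -- whole forward orbit moved, and `σ` agrees with `s` along it.
    have hmv : ∀ v, σ v ≠ v → ∀ n, σ (s^[n] v) ≠ s^[n] v ∧ (σ ^ n) v = s^[n] v := by
      intro v hv n
      induction n with
      | zero => exact ⟨hv, rfl⟩
      | succ n ih =>
        rw [Function.iterate_succ_apply', pow_succ', Equiv.Perm.mul_apply, ih.2]
        have h1 := (hM _).resolve_left ih.1
        refine ⟨fun h => ?_, h1⟩
        rw [← h1] at h
        exact ih.1 (σ.injective h)
    have hmem : ∀ v, σ v ≠ v → v ∈ P := by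
      intro v hv
      obtain ⟨n, hn⟩ := hreach v
      have ho := orderOf_pos σ
      have hle : n ≤ orderOf σ * n := Nat.le_mul_of_pos_left n ho
      -- A moved point returns to itself after `orderOf σ * n` steps of `s`, and its orbit is in `P`
      -- after `n` steps; the remaining steps stay in `P`.
      refine (hP _ hn v).2 ⟨orderOf σ * n - n, ?_⟩
      rw [← Function.iterate_add_apply, Nat.sub_add_cancel hle, ← (hmv v hv _).2, pow_mul,
        pow_orderOf_eq_one, one_pow, Equiv.Perm.one_apply]
    obtain ⟨v, hv⟩ : ∃ v, σ v ≠ v := by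
      by_contra! h
      exact hσ1 (Equiv.ext h)
    refine hσc (Equiv.ext fun w => ?_)
    rw [hc]
    split_ifs with hw
    · obtain ⟨n, rfl⟩ := (hP v (hmem v hv) w).1 hw
      exact (hM _).resolve_left (hmv v hv n).1
    · by_contra h
      exact hw (hmem w h)
  · simp
  · simp

end Matrix

/-! ### Factorization over components -/

namespace SimpleGraph

variable {V : Type*} {s : V → V} {H : SimpleGraph V}

namespace Orients

theorem det_ofMap [Fintype V] [DecidableEq V] {R : Type*} [CommRing R] (h : Orients s H)
    (C : ∀ ψ : H.ConnectedComponent, ComponentCycle ψ) (a b : V → R)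
    [∀ ψ : H.ConnectedComponent, DecidablePred (· ∈ ψ)] :
    (Matrix.ofMap s a b).det = ∏ ψ : H.ConnectedComponent,
      (∏ v with v ∈ ψ ∧ v ∉ (C ψ).walk.support, a v) *
        (∏ v ∈ (C ψ).walk.support.toFinset, a v - ∏ v ∈ (C ψ).walk.support.toFinset, b v) := by
  classical
  -- Any order will do: `s` preserves components, so all off-diagonal blocks vanish.
  let _ : LinearOrder H.ConnectedComponent :=
    LinearOrder.lift' (Fintype.equivFin _) (Fintype.equivFin _).injective
  have htri : (Matrix.ofMap s a b).BlockTriangular H.connectedComponentMk := by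
    intro v w hvw
    have h1 : w ≠ v := by
      rintro rfl
      exact lt_irrefl _ hvw
    have h2 : w ≠ s v := by
      rintro rfl
      rw [h.connectedComponentMk_apply] at hvw
      exact lt_irrefl _ hvw
    rw [Matrix.ofMap_apply, if_neg h1, if_neg h2, sub_zero]
  rw [htri.det_fintype]
  refine Finset.prod_congr rfl fun ψ _ => ?_
  let t : {v // H.connectedComponentMk v = ψ} → {v // H.connectedComponentMk v = ψ} :=
    fun v => ⟨s v, (h.connectedComponentMk_apply _).trans v.2⟩
  have hblock : (Matrix.ofMap s a b).toSquareBlock H.connectedComponentMk ψ =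
      Matrix.ofMap t (fun v => a v) (fun v => b v) := by
    ext v w
    rw [Matrix.toSquareBlock_def, Matrix.of_apply, Matrix.ofMap_apply, Matrix.ofMap_apply]
    simp only [t, Subtype.ext_iff]
  have hiter : ∀ n v, (t^[n] v : V) = s^[n] v := fun n v =>
    (Function.Semiconj.iterate_right (f := Subtype.val) (ga := t) (gb := s) (fun _ => rfl) n) v
  have hmem : ∀ v ∈ (C ψ).walk.support, H.connectedComponentMk v = ψ :=
    fun v hv => (C ψ).mem_of_mem_support hv
  let P : Finset {v // H.connectedComponentMk v = ψ} := {v | (v : V) ∈ (C ψ).walk.support}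
  have hP : ∀ v, v ∈ P ↔ (v : V) ∈ (C ψ).walk.support := fun v => by simp [P]
  rw [hblock, Matrix.det_ofMap_of_unique_cycle (s := t) (P := P)]
  · have hprod : ∀ f : V → R,
        ∏ v ∈ P, f v =
          ∏ v ∈ (C ψ).walk.support.toFinset, f v := fun f =>
      Finset.prod_nbij Subtype.val (by simp [hP]) Subtype.val_injective.injOn
        (fun v hv => ⟨⟨v, hmem v (by simpa using hv)⟩, by simpa [hP] using hv, rfl⟩) (fun _ _ => rfl)
    rw [hprod, hprod]
    congr 1
    refine Finset.prod_nbij Subtype.val ?_ Subtype.val_injective.injOn ?_ (fun _ _ => rfl)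
    · intro v hv
      simp only [Finset.mem_compl, Finset.mem_filter, Finset.mem_univ, true_and, hP] at hv ⊢
      exact ⟨v.2, hv⟩
    · intro v hv
      simp only [Finset.coe_filter, Finset.mem_univ, true_and, Set.mem_ofPred_eq] at hv
      exact ⟨⟨v, hv.1⟩, by simpa [hP] using hv.2, rfl⟩
  · exact fun v hv => (h.adj v).ne (congrArg Subtype.val hv).symm
  · exact ⟨⟨_, hmem _ (C ψ).walk.start_mem_support⟩, by simp [hP]⟩
  · intro v hv w
    rw [hP] at hv
    simp only [hP, h.mem_support_iff (C ψ).isCycle hv, Subtype.ext_iff, hiter]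
  · intro v
    simp only [hP, hiter]
    exact h.exists_iterate_mem_support (C ψ).isCycle
      (ConnectedComponent.exact (v.2.trans (C ψ).base_mem.symm))

/-- Products over the edges of a component are products over its vertices. -/
theorem prod_edges [Fintype V] {M : Type*} [CommMonoid M] (h : Orients s H)
    (ψ : H.ConnectedComponent) (q : Sym2 V → Prop) (q' : V → Prop) {_ : DecidablePred q}
    [DecidablePred fun v => v ∈ ψ ∧ q' v]
    (hq : ∀ v ∈ ψ, q s(v, s v) ↔ q' v) (r : Sym2 V → M) :
    ∏ e ∈ ψ.edges with q e, r e = ∏ v with v ∈ ψ ∧ q' v, r s(v, s v) := by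
  refine (Finset.prod_nbij (fun v => s(v, s v)) ?_ h.edge_injective.injOn ?_
    (fun _ _ => rfl)).symm
  · intro v hv
    simp only [Finset.mem_filter, Finset.mem_univ, true_and] at hv
    simp only [ConnectedComponent.edges, Finset.mem_filter, mem_edgeFinset, mem_edgeSet]
    refine ⟨⟨h.adj v, fun w hw => ?_⟩, (hq v hv.1).2 hv.2⟩
    rcases Sym2.mem_iff.1 hw with rfl | rfl
    · exact hv.1
    · exact h.mem_component hv.1
  · intro e he
    simp only [ConnectedComponent.edges, Finset.coe_filter, Finset.mem_filter, mem_edgeFinset,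
      Set.mem_ofPred_eq] at he
    obtain ⟨v, rfl⟩ := h.exists_edge_eq he.1.1
    have hv : v ∈ ψ := he.1.2 v (Sym2.mem_mk_left _ _)
    exact ⟨v, by simpa using ⟨hv, (hq v hv).1 he.2⟩, rfl⟩

end Orients

namespace Walk

variable [DecidableEq V] {u : V} {p : H.Walk u u} {M : Type*} [CommMonoid M]

theorem IsCycle.prod_support (hp : p.IsCycle) (f : V → M) :
    ∏ v ∈ p.support.toFinset, f v = ∏ i ∈ Finset.range p.length, f (p.getVert i) := by
  have h3 := hp.three_le_length
  refine (Finset.prod_nbij p.getVert (by simp) ?_ ?_ (fun _ _ => rfl)).symm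
  · exact hp.getVert_injOn'.mono fun i hi => by
      simp only [Finset.coe_range, Set.mem_Iio] at hi
      simp only [Set.mem_ofPred_eq]
      omega
  · intro v hv
    obtain ⟨i, hi, rfl⟩ := (mem_support_iff_exists_getVert_lt (by omega)).1
      (List.mem_toFinset.1 hv)
    exact ⟨i, by simpa using hi, rfl⟩

/-- The shifted indexing suits a cycle oriented against its traversal, where vertex `i + 1` is the
tail of edge `i`. -/
theorem IsCycle.prod_support_succ (hp : p.IsCycle) (f : V → M) :
    ∏ v ∈ p.support.toFinset, f v = ∏ i ∈ Finset.range p.length, f (p.getVert (i + 1)) := by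
  have h3 := hp.three_le_length
  refine (Finset.prod_nbij (fun i => p.getVert (i + 1)) (by simp) ?_ ?_ (fun _ _ => rfl)).symm
  · intro i hi j hj hij
    simp only [Finset.coe_range, Set.mem_Iio] at hi hj
    have := hp.getVert_injOn (by simp only [Set.mem_ofPred_eq]; omega)
      (by simp only [Set.mem_ofPred_eq]; omega) hij
    omega
  · intro v hv
    obtain ⟨i, hi, rfl⟩ := (mem_support_iff_exists_getVert_succ (by omega)).1
      (List.mem_toFinset.1 hv)
    exact ⟨i, by simpa using hi, rfl⟩

end Walk

end SimpleGraph

/-! ### Gains of walks and the expansion of the `g`-Laplacian -/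

namespace SkewGainGraph

open SimpleGraph

variable {V F : Type*} [Field F] (Φ : SkewGainGraph V Fˣ)

theorem adjMatrix_apply {u v : V} (h : Φ.graph.Adj u v) :
    Φ.adjMatrix u v = (Φ.φ ⟨(u, v), h⟩ : F) := by
  simp [adjMatrix, h]

theorem adjMatrix_apply_symm {u v : V} (h : Φ.graph.Adj u v) :
    Φ.adjMatrix v u = (Φ.f (Φ.φ ⟨(u, v), h⟩) : F) := by
  rw [Φ.adjMatrix_apply h.symm, ← Φ.φ_symm]
  rfl

theorem walkGain_eq_prod {u v : V} (p : Φ.graph.Walk u v) :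
    (Φ.walkGain p : F) =
      ∏ i ∈ Finset.range p.length, Φ.adjMatrix (p.getVert i) (p.getVert (i + 1)) := by
  induction p with
  | nil => simp [walkGain]
  | cons hadj p ih =>
    rw [Walk.length_cons, Finset.prod_range_succ', mul_comm]
    simp only [Walk.getVert_cons_succ, Walk.getVert_zero]
    rw [← ih, Φ.adjMatrix_apply hadj]
    simp [walkGain]

theorem f_walkGain_eq_prod {u v : V} (p : Φ.graph.Walk u v) :
    (Φ.f (Φ.walkGain p) : F) =
      ∏ i ∈ Finset.range p.length, Φ.adjMatrix (p.getVert (i + 1)) (p.getVert i) := by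
  induction p with
  | nil =>
    have h := Φ.f.map_mul' 1 1
    rw [mul_one, left_eq_mul] at h
    simp [walkGain, h]
  | cons hadj p ih =>
    rw [Walk.length_cons, Finset.prod_range_succ']
    simp only [Walk.getVert_cons_succ, Walk.getVert_zero]
    rw [← ih, Φ.adjMatrix_apply_symm hadj, ← Units.val_mul, ← Φ.f.map_mul']
    simp [walkGain]

variable (r : Sym2 V → AlgebraicClosure F)

open Classical in
/-- The contribution of a component `ψ` whose cycle is oriented as `C` or, if the last argument is
`false`, in the opposite direction. -/
noncomputable def orientedFactor [Fintype V] {Ψ : SimpleGraph V} (hΨ : Ψ ≤ Φ.graph)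
    (ψ : Ψ.ConnectedComponent) (C : ComponentCycle ψ) (o : Bool) : AlgebraicClosure F :=
  (∏ e ∈ ψ.edges with e ∉ C.walk.edges, r e) *
    ((∏ e ∈ ψ.edges with e ∈ C.walk.edges, r e) -
      algebraMap F (AlgebraicClosure F)
        (if o then Φ.walkGain (C.walk.mapLe hΨ) else Φ.f (Φ.walkGain (C.walk.mapLe hΨ)) : Fˣ))

theorem oneTreeFactor_eq_add [Fintype V] {Ψ : SimpleGraph V} (hΨ : Ψ ≤ Φ.graph)
    (ψ : Ψ.ConnectedComponent) (C : ComponentCycle ψ) :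
    Φ.oneTreeFactor r hΨ ψ C =
      Φ.orientedFactor r hΨ ψ C true + Φ.orientedFactor r hΨ ψ C false := by
  simp only [oneTreeFactor, orientedFactor, if_true, Bool.false_eq_true, if_false, map_add]
  ring

/-- The rows of the `g`-Laplacian are sums of `edgeRow` over the neighbours. -/
noncomputable def edgeRow [DecidableEq V] (v w : V) : V → AlgebraicClosure F :=
  open Classical in
  if Φ.graph.Adj v w then
    Pi.single v (r s(v, w)) - Pi.single w (algebraMap F _ (Φ.adjMatrix v w))
  else 0

variable {r} in
theorem of_edgeRow_eq_ofMap [DecidableEq V] {s : V → V} (hs : ∀ v, Φ.graph.Adj v (s v)) :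
    (Matrix.of fun v => Φ.edgeRow r v (s v)) = Matrix.ofMap s (fun v => r s(v, s v))
      (fun v => algebraMap F _ (Φ.adjMatrix v (s v))) := by
  ext v w
  simp [edgeRow, hs v, Matrix.ofMap]

variable [Fintype V] [DecidableEq V]

theorem gLaplacian_eq_sum_edgeRow :
    Φ.gLaplacian r = Matrix.of fun v => ∑ w, Φ.edgeRow r v w := by
  classical
  ext v w
  have hdiag : ∑ e ∈ Φ.graph.edgeFinset with v ∈ e, r e =
      ∑ x with Φ.graph.Adj v x, r s(v, x) := by
    refine (Finset.sum_nbij (fun x => s(v, x)) (by simp) (fun x _ y _ h => ?_) ?_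
      (fun _ _ => rfl)).symm
    · exact Sym2.congr_right.1 h
    · intro e he
      simp only [Finset.coe_filter, mem_edgeFinset, Set.mem_ofPred_eq] at he
      obtain ⟨x, rfl⟩ := he.2
      exact ⟨x, by simpa using he.1, rfl⟩
  have hrow : ∀ x, Φ.edgeRow r v x w = (if Φ.graph.Adj v x then
      (if w = v then r s(v, x) else 0) else 0) -
        if w = x then algebraMap F _ (Φ.adjMatrix v x) else 0 := by
    intro x
    by_cases h : Φ.graph.Adj v x
    · simp [edgeRow, h, Pi.single_apply]
    · simp [edgeRow, h, adjMatrix]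
  simp only [Matrix.of_apply, Finset.sum_apply, hrow, Finset.sum_sub_distrib,
    Finset.sum_ite_eq, Finset.mem_univ, if_true]
  rw [gLaplacian, Matrix.sub_apply, Matrix.map_apply, gDegreeMatrix,
    @Matrix.diagonal_apply V _ fun a b => Classical.propDecidable (a = b)]
  congr 1
  by_cases hvw : w = v
  · subst hvw
    simp only [if_true]
    rw [← Finset.sum_filter]
    convert hdiag
  · simp [hvw, Ne.symm hvw]

theorem det_gLaplacian_eq_sum :
    (Φ.gLaplacian r).det = ∑ s : V → V, (Matrix.of fun v => Φ.edgeRow r v (s v)).det := by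
  rw [gLaplacian_eq_sum_edgeRow]
  exact (Matrix.detRowAlternating (n := V) (R := AlgebraicClosure F)).toMultilinearMap.map_sum
    fun v w => Φ.edgeRow r v w

variable {r}

theorem det_edgeRow_eq_zero_of_not_adj {s : V → V} {v : V} (hv : ¬ Φ.graph.Adj v (s v)) :
    (Matrix.of fun v => Φ.edgeRow r v (s v)).det = 0 :=
  Matrix.det_eq_zero_of_row_eq_zero v fun w => by simp [edgeRow, hv]

theorem det_edgeRow_eq_zero_of_two_cycle (hr : Φ.IsSqrtChoice r) {s : V → V} {v : V}
    (hv : s (s v) = v) : (Matrix.of fun v => Φ.edgeRow r v (s v)).det = 0 := by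
  by_cases hs : Φ.graph.Adj v (s v)
  swap
  · exact Φ.det_edgeRow_eq_zero_of_not_adj hs
  have hne : s v ≠ v := hs.ne'
  have hr2 : r s(v, s v) ^ 2 = algebraMap F _ (Φ.adjMatrix v (s v)) *
      algebraMap F _ (Φ.adjMatrix (s v) v) := by
    have := hr ⟨(v, s v), hs⟩
    rw [Φ.adjMatrix_apply hs, Φ.adjMatrix_apply_symm hs, ← map_mul, ← Units.val_mul]
    exact this
  have hφ : algebraMap F (AlgebraicClosure F) (Φ.adjMatrix v (s v)) ≠ 0 := by
    rw [Φ.adjMatrix_apply hs]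
    simp
  rw [← Matrix.exists_vecMul_eq_zero_iff]
  -- Rows `v` and `s v` are dependent with coefficients `r` and `φ(v, s v)`: coordinate `s v`
  -- cancels identically, coordinate `v` by `r² = φ(v, s v) φ(s v, v)`. The second coefficient is a
  -- unit, so the relation is nontrivial.
  refine ⟨Pi.single v (r s(v, s v)) +
    Pi.single (s v) (algebraMap F _ (Φ.adjMatrix v (s v))), fun h => hφ ?_, ?_⟩
  · simpa [hne] using congrFun h (s v)
  · rw [Matrix.add_vecMul, Matrix.single_vecMul, Matrix.single_vecMul]
    ext w
    have hsw : s(s v, v) = s(v, s v) := Sym2.eq_swap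
    simp only [Matrix.row, Matrix.of_apply, hv, edgeRow, hs, hs.symm, if_true, Pi.add_apply,
      Pi.smul_apply, Pi.sub_apply, Pi.single_apply, Pi.zero_apply, smul_eq_mul, hsw]
    by_cases h1 : w = v
    · subst h1
      simp only [if_true, hne.symm, if_false]
      linear_combination hr2
    · simp only [h1, if_false]
      split_ifs <;> ring

variable (r)

theorem det_edgeRow_of_orients {Ψ : SimpleGraph V} (hΨ : Ψ ≤ Φ.graph) {s : V → V}
    (hs : Orients s Ψ) (C : ∀ ψ : Ψ.ConnectedComponent, ComponentCycle ψ) :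
    (Matrix.of fun v => Φ.edgeRow r v (s v)).det =
      ∏ ψ, Φ.orientedFactor r hΨ ψ (C ψ) (decide (s (C ψ).first = (C ψ).second)) := by
  classical
  rw [Φ.of_edgeRow_eq_ofMap fun v => hΨ (hs.adj v), hs.det_ofMap C]
  refine Finset.prod_congr rfl fun ψ _ => ?_
  have hcyc := (C ψ).isCycle
  rw [orientedFactor, hs.prod_edges ψ (· ∉ (C ψ).walk.edges) (· ∉ (C ψ).walk.support)
    (fun v _ => not_congr (hs.edge_mem_edges_iff hcyc v)), hs.prod_edges ψ
      (· ∈ (C ψ).walk.edges) (· ∈ (C ψ).walk.support)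
    (fun v _ => hs.edge_mem_edges_iff hcyc v)]
  congr 2
  · refine Finset.prod_congr ?_ fun _ _ => rfl
    ext v
    simpa using (C ψ).mem_of_mem_support
  · rw [← map_prod]
    congr 1
    by_cases h0 : s (C ψ).first = (C ψ).second
    · rw [if_pos (by simpa using h0), walkGain_eq_prod, hcyc.prod_support, Walk.length_map]
      refine Finset.prod_congr rfl fun i hi => ?_
      rw [hs.forward hcyc h0 (Finset.mem_range.1 hi), Walk.getVert_map, Walk.getVert_map]
      rfl
    · rw [if_neg (by simpa using h0), f_walkGain_eq_prod, hcyc.prod_support_succ,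
        Walk.length_map]
      refine Finset.prod_congr rfl fun i hi => ?_
      rw [hs.backward hcyc h0 (Finset.mem_range.1 hi), Walk.getVert_map, Walk.getVert_map]
      rfl

theorem exists_orients_of_det_edgeRow_ne_zero (hr : Φ.IsSqrtChoice r) {s : V → V}
    (hs : (Matrix.of fun v => Φ.edgeRow r v (s v)).det ≠ 0) : ∃ Ψ ≤ Φ.graph, Orients s Ψ := by
  have hadj : ∀ v, Φ.graph.Adj v (s v) := fun v => by
    by_contra h
    exact hs (Φ.det_edgeRow_eq_zero_of_not_adj h)
  refine ⟨⟨fun u v => s u = v ∨ s v = u, ⟨fun _ _ => Or.symm⟩,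
    ⟨fun v h => (hadj v).ne (or_self_iff.1 h).symm⟩⟩, ?_,
    fun v hv => hs (Φ.det_edgeRow_eq_zero_of_two_cycle hr hv), fun _ _ => Iff.rfl⟩
  rintro u v (h | h)
  · exact h ▸ hadj u
  · exact h ▸ (hadj v).symm

end SkewGainGraph

theorem mainTheorem1 {V F : Type*} [Fintype V] [DecidableEq V] [Field F] [CharZero F]
    (Φ : SkewGainGraph V Fˣ)
    (r : Sym2 V → AlgebraicClosure F) (hr : Φ.IsSqrtChoice r)
    (C : ∀ (Ψ : Φ.graph.EssentialSpanningSubgraph) (ψ : Ψ.1.ConnectedComponent),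
      SimpleGraph.ComponentCycle ψ) :
    (Φ.gLaplacian r).det =
      ∑ Ψ : Φ.graph.EssentialSpanningSubgraph,
        ∏ ψ : Ψ.1.ConnectedComponent, Φ.oneTreeFactor r Ψ.2.1 ψ (C Ψ ψ) := by
  classical
  have hΨ : ∀ Ψ : Φ.graph.EssentialSpanningSubgraph,
      ∏ ψ : Ψ.1.ConnectedComponent, Φ.oneTreeFactor r Ψ.2.1 ψ (C Ψ ψ) =
        ∑ s : V → V, if SimpleGraph.Orients s Ψ.1 then
          (Matrix.of fun v => Φ.edgeRow r v (s v)).det else 0 := by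
    intro Ψ
    simp only [Φ.oneTreeFactor_eq_add]
    rw [← Ψ.2.2.sum_orients (C Ψ) fun ψ => Φ.orientedFactor r Ψ.2.1 ψ (C Ψ ψ),
      ← Finset.sum_filter]
    exact Finset.sum_congr rfl fun s hs =>
      (Φ.det_edgeRow_of_orients r Ψ.2.1 (Finset.mem_filter.1 hs).2 (C Ψ)).symm
  simp only [hΨ]
  rw [Finset.sum_comm, Φ.det_gLaplacian_eq_sum]
  refine Finset.sum_congr rfl fun s _ => ?_
  by_cases hdet : (Matrix.of fun v => Φ.edgeRow r v (s v)).det = 0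
  · simp [hdet]
  -- Exactly one `Ψ` contributes, since `s` determines the edges of any graph it orients.
  · obtain ⟨Ψ, hle, hs⟩ := Φ.exists_orients_of_det_edgeRow_ne_zero r hr hdet
    let Ψ₀ : Φ.graph.EssentialSpanningSubgraph := ⟨Ψ, hle, hs.isOneForest⟩
    refine ((if_pos hs).symm.trans (Finset.sum_eq_single_of_mem (f := fun Ψ' :
      Φ.graph.EssentialSpanningSubgraph => if SimpleGraph.Orients s Ψ'.1 then
        (Matrix.of fun v => Φ.edgeRow r v (s v)).det else 0) Ψ₀ (Finset.mem_univ _) ?_).symm)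
    intro Ψ' _ hne
    refine if_neg fun hs' => hne (Subtype.ext ?_)
    ext u v
    rw [hs.2, hs'.2]
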